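/- Let $X$ be a separable metrizable topological space and let $C_b(X)$ be the space of bounded continuous functions $X\to\mathbb{R}$. For a compact set $Q\subseteq\beta X\setminus X$, where $\beta X$ is the Stone–Čech compactification of $X$, let $\beta_Q$ be the locally convex topology on $C_b(X)$ generated by the seminorms $f\mapsto\sup_{x\in X}|f(x)h(x)|$, where $h$ runs through the continuous functions $\beta X\to\mathbb{R}$ that vanish on $Q$. The strict topology $\beta$ on $C_b(X)$ is the finest locally convex vector space topology that is coarser than $\beta_Q$ for every compact $Q\subseteq\beta X\setminus X$. Let $\mathcal{M}_\tau(X)$ be the vector space of $\tau$-additive finite signed Borel measures on $X$, that is, of those $\mu$ with $\lim_\alpha|\mu|(U_\alpha)=|\mu|\left(\bigcup_\alpha U_\alpha\right)$ for every increasing net $(U_\alpha)_\alpha$ of open sets. Then the following hold. 1. The map $\mu\mapsto\left(f\mapsto\int f\,d\mu\right)$ is a linear isomorphism of $\mathcal{M}_\tau(X)$ onto the continuous dual space $(C_b(X),\beta)'$. 2. This dual space is weakly sequentially complete: every sequence in $(C_b(X),\beta)'$ that is Cauchy for the topology $\sigma((C_b(X),\beta)',C_b(X))$ converges in this topology to an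 element of $(C_b(X),\beta)'$. 3. Equivalently, if $(\mu_n)_{n\in\mathbb{N}}$ is a sequence in $\mathcal{M}_\tau(X)$ such that $\left(\int f\,d\mu_n\right)_n$ is a Cauchy sequence in $\mathbb{R}$ for every $f\in C_b(X)$, then there is $\mu\in\mathcal{M}_\tau(X)$ with $\int f\,d\mu_n\to\int f\,d\mu$ for every $f\in C_b(X)$. -/

import Mathlib

open Filter Topology MeasureTheory
open scoped BoundedContinuousFunction ENNReal

universe u

noncomputable section

/-! ### The strict topology on bounded continuous functions -/

section Strict

variable (X : Type u) [TopologicalSpace X]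

/-- The restriction to `X` of a continuous function on the Stone–Čech compactification of `X`. -/
def restrictStoneCech (h : C(StoneCech X, ℝ)) : X →ᵇ ℝ :=
  (BoundedContinuousFunction.mkOfCompact h).compContinuous
    ⟨stoneCechUnit, continuous_stoneCechUnit⟩

/-- For `Q ⊆ βX`, the seminorms `f ↦ ‖f h‖_∞` on `C_b(X)`, where `h` runs through the continuous
functions on `βX` that vanish on `Q`. -/
def strictSeminorm (Q : Set (StoneCech X)) :
    SeminormFamily ℝ (X →ᵇ ℝ) {h : C(StoneCech X, ℝ) // ∀ q ∈ Q, h q = 0} :=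
  fun h => (normSeminorm ℝ (X →ᵇ ℝ)).comp (LinearMap.mulRight ℝ (restrictStoneCech X h.1))

instance (Q : Set (StoneCech X)) : Nonempty {h : C(StoneCech X, ℝ) // ∀ q ∈ Q, h q = 0} :=
  ⟨⟨0, fun _ _ => rfl⟩⟩

/-- The locally convex topology `β_Q` on `C_b(X)` generated by the seminorms `f ↦ ‖f h‖_∞`,
`h ∈ C(βX)`, `h = 0` on `Q`. -/
@[reducible] def strictTopologyAt (Q : Set (StoneCech X)) : TopologicalSpace (X →ᵇ ℝ) :=
  (strictSeminorm X Q).moduleFilterBasis.topology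

/-- The strict topology `β` on `C_b(X)`: the locally convex inductive limit of the topologies
`β_Q` over all compact `Q ⊆ βX \ X`, that is, the finest locally convex vector space topology that
is coarser than every `β_Q`. (In Mathlib `t₁ ≤ t₂` says that `t₁` is finer than `t₂`.) -/
@[reducible] def strictTopology : TopologicalSpace (X →ᵇ ℝ) :=
  sInf {t | @IsTopologicalAddGroup (X →ᵇ ℝ) t _ ∧ @ContinuousSMul ℝ (X →ᵇ ℝ) _ _ t ∧
    @LocallyConvexSpace ℝ (X →ᵇ ℝ) _ _ _ _ t ∧
    ∀ Q : Set (StoneCech X), IsCompact Q → Disjoint Q (Set.range stoneCechUnit) →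
      strictTopologyAt X Q ≤ t}

/-- The space `(C_b(X), β)`: real bounded continuous functions with the strict topology. -/
def StrictBCF : Type u := X →ᵇ ℝ

instance : AddCommGroup (StrictBCF X) := inferInstanceAs (AddCommGroup (X →ᵇ ℝ))

instance : Module ℝ (StrictBCF X) := inferInstanceAs (Module ℝ (X →ᵇ ℝ))

instance : TopologicalSpace (StrictBCF X) := strictTopology X

/-- The identity map from `C_b(X)` to `(C_b(X), β)`. -/
def toStrictBCF : (X →ᵇ ℝ) ≃ₗ[ℝ] StrictBCF X := LinearEquiv.refl ℝ (X →ᵇ ℝ)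

end Strict

/-! ### `τ`-additive measures -/

section Tau

variable {X : Type u} [TopologicalSpace X] [MeasurableSpace X]

/-- A finite signed Borel measure `μ` is `τ`-additive if `|μ|(U_i) → |μ|(⋃ i, U_i)` for every
increasing net of open sets. (Index sets in the universe of `X` suffice, since an increasing net of
subsets of `X` can be reindexed by its range.) -/
def IsTauAdditive (μ : SignedMeasure X) : Prop :=
  ∀ (ι : Type u) [Preorder ι] [IsDirectedOrder ι] [Nonempty ι] (U : ι → Set X),
    (∀ i, IsOpen (U i)) → Monotone U →
      Tendsto (fun i => μ.totalVariation (U i)) atTop (𝓝 (μ.totalVariation (⋃ i, U i)))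

theorem tendsto_measure_diff_iff [BorelSpace X] {ι : Type u} {l : Filter ι} (m : Measure X)
    [IsFiniteMeasure m] (U : ι → Set X) (hU : ∀ i, IsOpen (U i)) :
    Tendsto (fun i => m (U i)) l (𝓝 (m (⋃ i, U i))) ↔
      Tendsto (fun i => m ((⋃ i, U i) \ U i)) l (𝓝 0) := by
  have h1 : ∀ i, m ((⋃ i, U i) \ U i) = m (⋃ i, U i) - m (U i) := fun i =>
    measure_sdiff (Set.subset_iUnion U i) (hU i).measurableSet.nullMeasurableSet (by finiteness)
  have h2 : ∀ i, m (U i) = m (⋃ i, U i) - m ((⋃ i, U i) \ U i) := fun i => by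
    rw [h1, ENNReal.sub_sub_cancel (by finiteness) (measure_mono (Set.subset_iUnion U i))]
  constructor
  · intro h
    simp_rw [h1]
    have := ENNReal.Tendsto.sub (tendsto_const_nhds (x := m (⋃ i, U i)) (f := l)) h
      (Or.inl (by finiteness))
    simpa using this
  · intro h
    have := ENNReal.Tendsto.sub (tendsto_const_nhds (x := m (⋃ i, U i)) (f := l)) h
      (Or.inl (by finiteness))
    rw [tsub_zero] at this
    exact this.congr fun i => (h2 i).symm

instance isFiniteMeasure_totalVariation (μ : SignedMeasure X) :
    IsFiniteMeasure μ.totalVariation := by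
  unfold SignedMeasure.totalVariation
  infer_instance

variable (X) in
/-- The vector space `M_τ(X)` of `τ`-additive finite signed Borel measures on `X`. -/
def TauMeasure [BorelSpace X] : Submodule ℝ (SignedMeasure X) where
  carrier := {μ | IsTauAdditive μ}
  zero_mem' := by
    intro ι _ _ _ U _ _
    simp [SignedMeasure.totalVariation_zero]
  add_mem' := by
    intro μ ν hμ hν ι _ _ _ U hU hm
    rw [tendsto_measure_diff_iff _ U hU]
    have h1 := (tendsto_measure_diff_iff _ U hU).1 (hμ ι U hU hm)
    have h2 := (tendsto_measure_diff_iff _ U hU).1 (hν ι U hU hm)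
    have h3 := h1.add h2
    rw [add_zero] at h3
    refine tendsto_of_tendsto_of_tendsto_of_le_of_le tendsto_const_nhds h3 (fun _ => zero_le) ?_
    intro i
    simp only [SignedMeasure.totalVariation_eq_variation]
    exact VectorMeasure.variation_add_le _
  smul_mem' := by
    intro c μ hμ ι _ _ _ U hU hm
    have h := hμ ι U hU hm
    simp only [SignedMeasure.totalVariation_eq_variation] at h ⊢
    simp only [VectorMeasure.variation_smul, Measure.smul_apply]
    exact ENNReal.Tendsto.const_mul h (Or.inr (by simp))

end Tau

/-- A topological vector space is sequentially complete if each of its Cauchy sequences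
converges. -/
def IsSequentiallyComplete (E : Type*) [AddCommGroup E] [TopologicalSpace E] : Prop :=
  ∀ u : ℕ → E, Tendsto (fun p : ℕ × ℕ => u p.1 - u p.2) atTop (𝓝 0) →
    ∃ x : E, Tendsto u atTop (𝓝 x)

end

/-! A norm bounded functional `L` on `C_b(X)` is called `σ`-smooth if `L (f n) → 0` whenever `f n`
decreases pointwise to `0`. For separable metrizable `X` three classes of functionals coincide:
the strictly continuous ones, the bounded `σ`-smooth ones, and the integrals against signed Borel
measures. All these measures are `τ`-additive, since `X` is second countable
(`isTauAdditive_of_secondCountable`).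

* A functional is strictly continuous iff it is `β_Q`-continuous for every `Q`, and then a single
  `f ↦ ‖f h‖` with `h = 0` on `Q` dominates it. If `f n` decreases to `0`, the extensions of the
  `f n` to `βX` are all at least `ε` only on a compact `Q ⊆ βX \ X`. For this `Q`, compactness gives
  `‖(f n - ε)⁺ h‖ → 0`, so `L` is `σ`-smooth (`isSigmaSmooth_of_continuous_strictTopology`).
* If `L` is bounded and `σ`-smooth, so are `L⁺` and `L⁺ - L`. The Riesz measure on `βX` of such a
  positive functional vanishes on compact subsets of `βX \ X`; hence `X` has full outer measure and
  the measure can be pulled back to `X` (`exists_signedMeasure_of_isSigmaSmooth`).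
* For a signed measure `μ` and a compact `Q ⊆ βX \ X` there is `h` vanishing on `Q` with
  `∫ 1 / h d|μ| < ∞`, so `|∫ f dμ| ≤ C ‖f h‖` (`continuous_strictTopology_integralLM`).

Weak sequential completeness reduces to Alexandrov's theorem that a pointwise limit `L` of integrals
`∫ f dμ n` is `σ`-smooth (`isSigmaSmooth_of_tendsto_integralLM`). If `f j` decreases to `0`, the
truncations `u j = (f j - ε)⁺` are locally eventually zero, so any subfamily of the increments
`u j - u (j + 1)` sums to a bounded continuous function. Its integral against `μ n` depends
continuously on the subfamily, a point of the Cantor space, and Baire's theorem gives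
`∫ u k dμ n → 0` as `k → ∞`, up to a small error, uniformly in large `n`. -/

/-! ### Signed measures as functionals on `C_b(X)` -/

section TauAdditive

variable {X : Type u} [TopologicalSpace X] [MeasurableSpace X]

theorem isTauAdditive_of_secondCountable [SecondCountableTopology X]
    (μ : SignedMeasure X) : IsTauAdditive μ := by
  intro ι _ _ _ U hU hm
  classical
  have hmono : Monotone fun i => μ.totalVariation (U i) := fun i j h => measure_mono (hm h)
  have key : μ.totalVariation (⋃ i, U i) = ⨆ i, μ.totalVariation (U i) := by
    apply le_antisymm _ (iSup_le fun i => measure_mono (Set.subset_iUnion U i))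
    obtain ⟨T, hT, hTU⟩ := TopologicalSpace.isOpen_iUnion_countable U hU
    rw [← hTU]
    rcases T.eq_empty_or_nonempty with rfl | hne
    · simp
    obtain ⟨s, rfl⟩ := hT.exists_eq_range hne
    rw [Set.biUnion_range, measure_iUnion_eq_iSup_accumulate]
    refine iSup_le fun n => ?_
    obtain ⟨j, hj⟩ := Finset.exists_le ((Finset.range (n + 1)).image s)
    refine le_trans (measure_mono ?_) (le_iSup (fun i => μ.totalVariation (U i)) j)
    refine Set.iUnion₂_subset fun k hk => hm (hj _ ?_)
    exact Finset.mem_image_of_mem _ (Finset.mem_range.2 (Nat.lt_succ_of_le hk))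
  rw [key]
  exact tendsto_atTop_iSup hmono

end TauAdditive

/-- For real `f` the pairings `∂•` and `∂<•` agree, since multiplication is commutative. -/
theorem integral_lsmul_toSignedMeasure {X : Type*} [MeasurableSpace X] (m : Measure X)
    [IsFiniteMeasure m] (f : X → ℝ) :
    ∫ᵛ x, f x ∂•m.toSignedMeasure = ∫ x, f x ∂m := by
  have h : (ContinuousLinearMap.lsmul ℝ ℝ : ℝ →L[ℝ] ℝ →L[ℝ] ℝ) =
      (ContinuousLinearMap.lsmul ℝ ℝ : ℝ →L[ℝ] ℝ →L[ℝ] ℝ).flip := by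
    ext; simp
  rw [h]
  exact VectorMeasure.integral_toSignedMeasure

section Integral

variable {X : Type u} [TopologicalSpace X] [MeasurableSpace X] [BorelSpace X]

instance isFiniteMeasure_variation (μ : SignedMeasure X) : IsFiniteMeasure μ.variation := by
  rw [← SignedMeasure.totalVariation_eq_variation]; infer_instance

theorem BoundedContinuousFunction.integrable_signedMeasure (μ : SignedMeasure X) (f : X →ᵇ ℝ) :
    μ.Integrable f := f.integrable _

/-- Integration against a signed Borel measure, as a linear functional on `C_b(X)`. -/
noncomputable def integralLM (μ : SignedMeasure X) : (X →ᵇ ℝ) →ₗ[ℝ] ℝ where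
  toFun f := ∫ᵛ x, f x ∂•μ
  map_add' f g := VectorMeasure.integral_fun_add (f.integrable_signedMeasure μ)
    (g.integrable_signedMeasure μ)
  map_smul' c f := VectorMeasure.integral_fun_smul (μ := μ) (B := ContinuousLinearMap.lsmul ℝ ℝ) c f

theorem integralLM_apply (μ : SignedMeasure X) (f : X →ᵇ ℝ) :
    integralLM μ f = ∫ᵛ x, f x ∂•μ := rfl

theorem abs_integralLM_le (μ : SignedMeasure X) (f : X →ᵇ ℝ) :
    |integralLM μ f| ≤ ∫ x, |f x| ∂μ.variation := by
  have h := VectorMeasure.norm_integral_le_integral_norm (μ := μ) (f := f)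
    (B := ContinuousLinearMap.lsmul ℝ ℝ)
  rw [Real.norm_eq_abs] at h
  refine h.trans ?_
  have h1 : ‖(ContinuousLinearMap.lsmul ℝ ℝ : ℝ →L[ℝ] ℝ →L[ℝ] ℝ)‖ ≤ 1 :=
    ContinuousLinearMap.opNorm_lsmul_le
  have h2 : (0:ℝ) ≤ ∫ x, ‖f x‖ ∂μ.variation := integral_nonneg fun _ => norm_nonneg _
  calc _ ≤ 1 * ∫ x, ‖f x‖ ∂μ.variation := by gcongr
    _ = _ := by simp

theorem integralLM_sub_toSignedMeasure (m₁ m₂ : Measure X) [IsFiniteMeasure m₁]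
    [IsFiniteMeasure m₂] (f : X →ᵇ ℝ) :
    integralLM (m₁.toSignedMeasure - m₂.toSignedMeasure) f =
      ∫ x, f x ∂m₁ - ∫ x, f x ∂m₂ := by
  rw [integralLM_apply, VectorMeasure.integral_sub_vectorMeasure
    (f.integrable_signedMeasure _) (f.integrable_signedMeasure _),
    integral_lsmul_toSignedMeasure, integral_lsmul_toSignedMeasure]

theorem integralLM_injective [HasOuterApproxClosed X] :
    Function.Injective (integralLM : SignedMeasure X → ((X →ᵇ ℝ) →ₗ[ℝ] ℝ)) := by
  intro μ ν h
  have hμ := μ.toSignedMeasure_toJordanDecomposition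
  have hν := ν.toSignedMeasure_toJordanDecomposition
  rw [JordanDecomposition.toSignedMeasure] at hμ hν
  set a := μ.toJordanDecomposition
  set b := ν.toJordanDecomposition
  -- compare the positive measures `μ⁺ + ν⁻` and `ν⁺ + μ⁻`
  have key : a.posPart + b.negPart = b.posPart + a.negPart := by
    apply ext_of_forall_integral_eq_of_IsFiniteMeasure
    intro f
    have h1 := integralLM_sub_toSignedMeasure a.posPart a.negPart f
    have h2 := integralLM_sub_toSignedMeasure b.posPart b.negPart f
    rw [hμ] at h1
    rw [hν, ← h] at h2
    rw [integral_add_measure (f.integrable _) (f.integrable _),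
      integral_add_measure (f.integrable _) (f.integrable _)]
    linarith
  have key' := Measure.toSignedMeasure_congr key
  rw [Measure.toSignedMeasure_add, Measure.toSignedMeasure_add] at key'
  rw [← hμ, ← hν, sub_eq_sub_iff_add_eq_add]
  exact key'

end Integral

/-- A functional on `C_b(X)` is `σ`-smooth if it tends to `0` along every sequence of functions
that decreases pointwise to `0`. -/
def IsSigmaSmooth {X : Type u} [TopologicalSpace X] (L : (X →ᵇ ℝ) → ℝ) : Prop :=
  ∀ f : ℕ → X →ᵇ ℝ, Antitone f → (∀ x, Tendsto (fun n => f n x) atTop (𝓝 0)) →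
    Tendsto (fun n => L (f n)) atTop (𝓝 0)

theorem nonneg_of_antitone_of_tendsto_zero {X : Type u} [TopologicalSpace X] {f : ℕ → X →ᵇ ℝ}
    (hf : Antitone f) (h0 : ∀ x, Tendsto (fun n => f n x) atTop (𝓝 0)) (n : ℕ) (x : X) :
    0 ≤ f n x :=
  Antitone.le_of_tendsto (fun _ _ h => hf h x) (h0 x) n

theorem tendsto_integralLM {X : Type u} [TopologicalSpace X] [MeasurableSpace X] [BorelSpace X]
    (μ : SignedMeasure X) {f : ℕ → X →ᵇ ℝ} (hf : Antitone f)
    (h0 : ∀ x, Tendsto (fun n => f n x) atTop (𝓝 0)) :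
    Tendsto (fun n => integralLM μ (f n)) atTop (𝓝 0) := by
  have h : Tendsto (fun n => ∫ᵛ x, f n x ∂•μ) atTop (𝓝 (∫ᵛ _, (0 : ℝ) ∂•μ)) := by
    refine VectorMeasure.tendsto_integral_filter_of_norm_le_const
      (Eventually.of_forall fun n => ((f n).integrable_signedMeasure μ).aestronglyMeasurable)
      ⟨‖f 0‖, Eventually.of_forall fun n => Eventually.of_forall fun x => ?_⟩
      (Eventually.of_forall h0)
    rw [Real.norm_of_nonneg (nonneg_of_antitone_of_tendsto_zero hf h0 n x)]
    exact (hf (Nat.zero_le n) x).trans ((le_abs_self _).trans ((f 0).norm_coe_le_norm x))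
  simpa [integralLM_apply] using h

/-! ### The positive part of a functional -/

section PosPart

variable {X : Type u} [TopologicalSpace X]

/-- The positive part `L⁺(f) = sup {L g | 0 ≤ g ≤ f}` of a functional on `C_b(X)`. It is meaningful
for `f ≥ 0` only, where it is additive if `L` is linear and bounded. -/
noncomputable def posPartFun (L : (X →ᵇ ℝ) →L[ℝ] ℝ) (f : X →ᵇ ℝ) : ℝ :=
  sSup (L '' Set.Icc 0 f)

variable (L : (X →ᵇ ℝ) →L[ℝ] ℝ)

theorem norm_le_of_mem_Icc {f g : X →ᵇ ℝ} (h : g ∈ Set.Icc 0 f) : ‖g‖ ≤ ‖f‖ := by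
  refine (BoundedContinuousFunction.norm_le (norm_nonneg _)).2 fun x => ?_
  have h0 : 0 ≤ g x := h.1 x
  have h1 : g x ≤ f x := h.2 x
  rw [Real.norm_of_nonneg h0]
  exact h1.trans ((le_abs_self _).trans (f.norm_coe_le_norm x))

theorem bddAbove_image_Icc (f : X →ᵇ ℝ) : BddAbove (L '' Set.Icc 0 f) := by
  refine ⟨‖L‖ * ‖f‖, ?_⟩
  rintro _ ⟨g, hg, rfl⟩
  calc L g ≤ ‖L g‖ := le_abs_self _
    _ ≤ ‖L‖ * ‖g‖ := L.le_opNorm g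
    _ ≤ ‖L‖ * ‖f‖ := by gcongr; exact norm_le_of_mem_Icc hg

theorem le_posPartFun {f g : X →ᵇ ℝ} (hg : g ∈ Set.Icc 0 f) : L g ≤ posPartFun L f :=
  le_csSup (bddAbove_image_Icc L f) ⟨g, hg, rfl⟩

theorem posPartFun_le {f : X →ᵇ ℝ} (hf : 0 ≤ f) {c : ℝ} (h : ∀ g ∈ Set.Icc 0 f, L g ≤ c) :
    posPartFun L f ≤ c := by
  refine csSup_le ⟨_, 0, ⟨le_rfl, hf⟩, rfl⟩ ?_
  rintro _ ⟨g, hg, rfl⟩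
  exact h g hg

theorem posPartFun_nonneg {f : X →ᵇ ℝ} (hf : 0 ≤ f) : 0 ≤ posPartFun L f := by
  simpa using le_posPartFun L (f := f) (g := 0) ⟨le_rfl, hf⟩

theorem posPartFun_add {f g : X →ᵇ ℝ} (hf : 0 ≤ f) (hg : 0 ≤ g) :
    posPartFun L (f + g) = posPartFun L f + posPartFun L g := by
  apply le_antisymm
  · refine posPartFun_le L (add_nonneg hf hg) fun k hk => ?_
    -- Riesz decomposition of `0 ≤ k ≤ f + g`
    have h1 : k ⊓ f ∈ Set.Icc 0 f := ⟨le_inf hk.1 hf, inf_le_right⟩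
    have h2 : k - k ⊓ f ∈ Set.Icc 0 g := by
      refine ⟨sub_nonneg.2 inf_le_left, fun x => ?_⟩
      have h3 : k x ≤ f x + g x := hk.2 x
      have h4 : 0 ≤ g x := hg x
      change k x - min (k x) (f x) ≤ g x
      rcases min_choice (k x) (f x) with h | h <;> rw [h] <;> linarith
    have h3 := le_posPartFun L h1
    have h4 := le_posPartFun L h2
    rw [map_sub] at h4
    linarith
  · have h1 : posPartFun L f ≤ posPartFun L (f + g) - posPartFun L g := by
      refine posPartFun_le L hf fun a ha => ?_
      rw [le_sub_iff_add_le, ← le_sub_iff_add_le']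
      refine posPartFun_le L hg fun b hb => ?_
      have := le_posPartFun L (f := f + g) (g := a + b)
        ⟨add_nonneg ha.1 hb.1, add_le_add ha.2 hb.2⟩
      rw [map_add] at this
      linarith
    linarith

theorem posPartFun_zero : posPartFun L 0 = 0 := by
  have := posPartFun_add L (le_refl (0 : X →ᵇ ℝ)) (le_refl 0)
  rw [add_zero] at this
  linarith

theorem posPartFun_smul {c : ℝ} (hc : 0 ≤ c) {f : X →ᵇ ℝ} (hf : 0 ≤ f) :
    posPartFun L (c • f) = c * posPartFun L f := by
  have key : ∀ {c : ℝ} {f : X →ᵇ ℝ}, 0 < c → 0 ≤ f →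
      c * posPartFun L f ≤ posPartFun L (c • f) := by
    intro c f hc hf
    rw [← le_div_iff₀' hc]
    refine posPartFun_le L hf fun g hg => ?_
    rw [le_div_iff₀' hc]
    have := le_posPartFun L (f := c • f) (g := c • g)
      ⟨fun x => mul_nonneg hc.le (hg.1 x), fun x => mul_le_mul_of_nonneg_left (hg.2 x) hc.le⟩
    simpa using this
  rcases hc.eq_or_lt with rfl | hc
  · simp [posPartFun_zero]
  · refine le_antisymm ?_ (key hc hf)
    have := key (inv_pos.2 hc) (f := c • f) (fun x => mul_nonneg hc.le (hf x))
    rwa [smul_smul, inv_mul_cancel₀ hc.ne', one_smul, inv_mul_le_iff₀ hc] at this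

/-- `L⁺` inherits `σ`-smoothness: if `L g` is nearly `L⁺ (f 0)` for some `0 ≤ g ≤ f 0`, then
`L⁺ (f 0 - f n) ≥ L (g - g ⊓ f n)`, where `L (g ⊓ f n) → 0`. -/
theorem IsSigmaSmooth.posPartFun {L : (X →ᵇ ℝ) →L[ℝ] ℝ} (hL : IsSigmaSmooth L) :
    IsSigmaSmooth (posPartFun L) := by
  intro f hf h0
  have hnn : ∀ n, 0 ≤ f n := fun n x => nonneg_of_antitone_of_tendsto_zero hf h0 n x
  rw [Metric.tendsto_atTop]
  intro ε hε
  obtain ⟨_, ⟨g, hg, rfl⟩, hlt⟩ := exists_lt_of_lt_csSup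
    (⟨_, 0, ⟨le_rfl, hnn 0⟩, rfl⟩ : (L '' Set.Icc 0 (f 0)).Nonempty)
    (sub_lt_self (_root_.posPartFun L (f 0)) (half_pos hε))
  have hlim : Tendsto (fun n => L (g ⊓ f n)) atTop (𝓝 0) := by
    refine hL (fun n => g ⊓ f n) (fun n m h => inf_le_inf_left g (hf h)) fun x => ?_
    have h1 : 0 ≤ g x := hg.1 x
    refine squeeze_zero (fun n => le_min h1 (hnn n x)) (fun n => min_le_right _ _) (h0 x)
  obtain ⟨N, hN⟩ := Metric.tendsto_atTop.1 hlim (ε / 2) (half_pos hε)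
  refine ⟨N, fun n hn => ?_⟩
  have h1 := hN n hn
  rw [Real.dist_eq, sub_zero] at h1 ⊢
  rw [abs_of_nonneg (posPartFun_nonneg L (hnn n))]
  have h2 : g - g ⊓ f n ∈ Set.Icc 0 (f 0 - f n) := by
    refine ⟨sub_nonneg.2 inf_le_left, fun x => ?_⟩
    have h3 : g x ≤ f 0 x := hg.2 x
    have h4 : f n x ≤ f 0 x := hf (Nat.zero_le n) x
    change g x - min (g x) (f n x) ≤ f 0 x - f n x
    rcases min_choice (g x) (f n x) with h | h <;> rw [h] <;> linarith
  have h3 := le_posPartFun L h2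
  rw [map_sub] at h3
  have h4 := posPartFun_add L (hnn n) (sub_nonneg.2 (hf (Nat.zero_le n)))
  rw [add_sub_cancel] at h4
  have h5 := (abs_lt.1 h1).2
  linarith

end PosPart

/-! ### Daniell representation by the Riesz measure on `βX` -/

/-- If `i(X)` has full outer measure for a finite measure `ν`, then `ν` is the image under `i` of
a measure on `X`. The set `i(X)` need not be measurable. -/
theorem exists_map_eq_of_outer_full {X Y : Type*} [MeasurableSpace Y] [MeasurableSpace X]
    (i : X → Y) (hi : MeasurableSpace.comap i inferInstance = ‹MeasurableSpace X›)
    (ν : Measure Y) [IsFiniteMeasure ν] (hν : ν (Set.range i) = ν Set.univ) :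
    ∃ m : Measure X, m.map i = ν := by
  have hle : ‹MeasurableSpace X› ≤ (OuterMeasure.comap i ν.toOuterMeasure).caratheodory := by
    rw [← hi]
    rintro _ ⟨B, hB, rfl⟩
    rw [OuterMeasure.isCaratheodory_iff]
    intro t
    simp only [OuterMeasure.comap_apply, Measure.coe_toOuterMeasure]
    rw [Set.image_inter_preimage, Set.image_sdiff_preimage]
    exact (measure_inter_add_sdiff _ hB).symm
  have hmeas : Measurable i := by
    rw [measurable_iff_comap_le, hi]
  refine ⟨(OuterMeasure.comap i ν.toOuterMeasure).toMeasure hle, ?_⟩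
  ext B hB
  rw [Measure.map_apply hmeas hB, toMeasure_apply _ _ (hmeas hB), OuterMeasure.comap_apply,
    Measure.coe_toOuterMeasure, Set.image_preimage_eq_range_inter]
  refine le_antisymm (measure_mono Set.inter_subset_right) ?_
  have h1 := measure_inter_add_sdiff (μ := ν) (Set.range i) hB
  have h2 := measure_add_measure_compl (μ := ν) hB
  rw [hν, ← h2] at h1
  have h3 : ν (Set.range i \ B) ≤ ν Bᶜ := measure_mono fun x hx => hx.2
  refine (ENNReal.add_le_add_iff_right (measure_ne_top ν Bᶜ)).1 ?_
  calc _ = _ := h1.symm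
    _ ≤ _ := by gcongr

section Riesz
open scoped NNReal CompactlySupported

variable {X : Type u} [TopologicalSpace X]

theorem restrictStoneCech_apply (h : C(StoneCech X, ℝ)) (x : X) :
    restrictStoneCech X h x = h (stoneCechUnit x) := rfl

theorem exists_restrictStoneCech_eq (f : X →ᵇ ℝ) :
    ∃ F : C(StoneCech X, ℝ), restrictStoneCech X F = f := by
  have hmem : ∀ x, f x ∈ Set.Icc (-‖f‖) ‖f‖ := fun x => abs_le.1 (f.norm_coe_le_norm x)
  have hc : Continuous fun x => (⟨f x, hmem x⟩ : Set.Icc (-‖f‖) ‖f‖) :=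
    f.continuous.subtype_mk _
  refine ⟨⟨fun z => ((stoneCechExtend hc z : Set.Icc (-‖f‖) ‖f‖) : ℝ),
    continuous_subtype_val.comp (continuous_stoneCechExtend hc)⟩, ?_⟩
  ext x
  rw [restrictStoneCech_apply, ContinuousMap.coe_mk, stoneCechExtend_stoneCechUnit]

/-- In a second countable space the complement of a compact `Q ⊆ βX \ X` contains a cozero set
of `βX` that contains `X`. -/
theorem exists_continuous_pos_of_disjoint [SecondCountableTopology X] {Q : Set (StoneCech X)}
    (hQ : IsCompact Q) (hd : Disjoint Q (Set.range stoneCechUnit)) :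
    ∃ h : C(StoneCech X, ℝ), (∀ q ∈ Q, h q = 0) ∧ (∀ z, 0 ≤ h z) ∧
      ∀ x, 0 < h (stoneCechUnit x) := by
  have hx : ∀ x : X, ∃ f : C(StoneCech X, ℝ), Set.EqOn f 0 Q ∧
      Set.EqOn f 1 {stoneCechUnit x} ∧ ∀ z, f z ∈ Set.Icc (0 : ℝ) 1 := fun x =>
    exists_continuous_zero_one_of_isClosed hQ.isClosed isClosed_singleton
      (Set.disjoint_singleton_right.2 fun h => Set.disjoint_left.1 hd h ⟨x, rfl⟩)
  choose f hf0 hf1 hf using hx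
  have hcov : ∀ x : X, {y | 0 < f x (stoneCechUnit y)} ∈ 𝓝 x := fun x => by
    refine (isOpen_lt continuous_const
      ((f x).continuous.comp continuous_stoneCechUnit)).mem_nhds ?_
    have := hf1 x rfl
    simp only [Pi.one_apply] at this
    simp [this]
  obtain ⟨s, hs, hsu⟩ := TopologicalSpace.countable_cover_nhds hcov
  rcases s.eq_empty_or_nonempty with rfl | hne
  · refine ⟨0, fun _ _ => rfl, fun _ => le_rfl, fun x => ?_⟩
    have := hsu.symm ▸ Set.mem_univ x
    simp at this
  obtain ⟨e, rfl⟩ := hs.exists_eq_range hne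
  have hb : ∀ n z, ‖(1 / 2 : ℝ) ^ n * f (e n) z‖ ≤ (1 / 2 : ℝ) ^ n := fun n z => by
    rw [Real.norm_of_nonneg (mul_nonneg (by positivity) (hf _ _).1)]
    exact mul_le_of_le_one_right (by positivity) (hf _ _).2
  have hsum : ∀ z, Summable fun n => (1 / 2 : ℝ) ^ n * f (e n) z := fun z =>
    Summable.of_norm_bounded summable_geometric_two fun n => hb n z
  refine ⟨⟨fun z => ∑' n, (1 / 2 : ℝ) ^ n * f (e n) z, continuous_tsum (fun n => by fun_prop)
    summable_geometric_two hb⟩, fun q hq => ?_, fun z => ?_, fun x => ?_⟩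
  · have : ∀ n, f (e n) q = 0 := fun n => hf0 _ hq
    simp [this]
  · exact tsum_nonneg fun n => mul_nonneg (by positivity) (hf _ _).1
  · have hxu := hsu.symm ▸ Set.mem_univ x
    simp only [Set.biUnion_range, Set.mem_iUnion, Set.mem_ofPred_eq] at hxu
    obtain ⟨n, hn⟩ := hxu
    exact (hsum _).tsum_pos (fun n => mul_nonneg (by positivity) (hf _ _).1) n
      (mul_pos (by positivity) hn)

/-- The restriction to `X` of a nonnegative continuous function on `βX`. -/
noncomputable def restrictNNReal (F : C_c(StoneCech X, ℝ≥0)) : X →ᵇ ℝ :=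
  restrictStoneCech X ⟨fun z => (F z : ℝ), by fun_prop⟩

theorem restrictNNReal_apply (F : C_c(StoneCech X, ℝ≥0)) (x : X) :
    restrictNNReal F x = F (stoneCechUnit x) := rfl

theorem restrictNNReal_nonneg (F : C_c(StoneCech X, ℝ≥0)) : 0 ≤ restrictNNReal F :=
  fun x => (F (stoneCechUnit x)).2

/-- **Daniell representation**: a positive `σ`-smooth functional on the cone of nonnegative bounded
continuous functions is integration against a finite measure. The Riesz measure on `βX` vanishes on
every compact `Q ⊆ βX \ X`, because the functions `(1 - n h)⁺`, where `h ≥ 0` vanishes on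
`Q` and is positive on `X`, decrease to `0` on `X`. -/
theorem exists_measure_of_isSigmaSmooth [SecondCountableTopology X] [CompletelyRegularSpace X]
    [MeasurableSpace X] [BorelSpace X] (P : (X →ᵇ ℝ) → ℝ) (hP : IsSigmaSmooth P)
    (hnn : ∀ f, 0 ≤ f → 0 ≤ P f) (hadd : ∀ f g, 0 ≤ f → 0 ≤ g → P (f + g) = P f + P g)
    (hsmul : ∀ (c : ℝ) f, 0 ≤ c → 0 ≤ f → P (c • f) = c * P f) :
    ∃ m : Measure X, IsFiniteMeasure m ∧ ∀ f : X →ᵇ ℝ, 0 ≤ f → P f = ∫ x, f x ∂m := by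
  borelize (StoneCech X)
  let Λ : C_c(StoneCech X, ℝ≥0) →ₗ[ℝ≥0] ℝ≥0 :=
    { toFun := fun F => ⟨P (restrictNNReal F), hnn _ (restrictNNReal_nonneg F)⟩
      map_add' := fun F G => by
        ext
        have : restrictNNReal (F + G) = restrictNNReal F + restrictNNReal G := by
          ext x; simp [restrictNNReal_apply]
        simp only [this, hadd _ _ (restrictNNReal_nonneg F) (restrictNNReal_nonneg G)]
        rfl
      map_smul' := fun c F => by
        ext
        have : restrictNNReal (c • F) = (c : ℝ) • restrictNNReal F := by
          ext x; simp [restrictNNReal_apply]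
        simp only [this]
        exact hsmul _ _ c.2 (restrictNNReal_nonneg F) }
  set ν := NNRealRMK.rieszMeasure Λ with hνdef
  have hreg : ν.Regular := by rw [hνdef]; unfold NNRealRMK.rieszMeasure; infer_instance
  have hint : ∀ F : C_c(StoneCech X, ℝ≥0), ∫ z, (F z : ℝ) ∂ν = P (restrictNNReal F) := fun F =>
    NNRealRMK.integral_rieszMeasure Λ F
  have hfin : IsFiniteMeasure ν := ⟨isCompact_univ.measure_lt_top⟩
  have hnull : ∀ Q : Set (StoneCech X), IsCompact Q →
      Disjoint Q (Set.range stoneCechUnit) → ν Q = 0 := by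
    intro Q hQ hd
    obtain ⟨h, hQ0, hh0, hpos⟩ := exists_continuous_pos_of_disjoint hQ hd
    let F : ℕ → C_c(StoneCech X, ℝ≥0) := fun n =>
      ⟨⟨fun z => Real.toNNReal (1 - n * h z), by fun_prop⟩, HasCompactSupport.of_compactSpace _⟩
    have hF : ∀ n z, (F n z : ℝ) = max (1 - n * h z) 0 := fun n z => rfl
    have hlim : Tendsto (fun n => P (restrictNNReal (F n))) atTop (𝓝 0) := by
      refine hP _ (fun n m hnm x => ?_) fun x => ?_
      · change ((F m (stoneCechUnit x) : ℝ≥0) : ℝ) ≤ F n (stoneCechUnit x)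
        rw [hF, hF]
        have := hh0 (stoneCechUnit x)
        gcongr
      · refine tendsto_const_nhds.congr' ?_
        obtain ⟨N, hN⟩ := exists_nat_gt (1 / h (stoneCechUnit x))
        filter_upwards [eventually_ge_atTop N] with n hn
        rw [restrictNNReal_apply, hF, max_eq_right]
        rw [div_lt_iff₀ (hpos x)] at hN
        have : (N : ℝ) * h (stoneCechUnit x) ≤ n * h (stoneCechUnit x) := by
          have := (hpos x).le
          gcongr
        linarith
    have hle : ∀ n, ν.real Q ≤ P (restrictNNReal (F n)) := by
      intro n
      rw [← hint, ← setIntegral_one_eq_measureReal, ← integral_indicator hQ.measurableSet]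
      refine integral_mono ((integrable_const _).indicator hQ.measurableSet) ?_ fun z => ?_
      · exact (BoundedContinuousFunction.mkOfCompact
          ⟨fun z => (F n z : ℝ), by fun_prop⟩).integrable ν
      · by_cases hz : z ∈ Q
        · simp [hz, hF, hQ0 z hz]
        · simp [hz]
    have h0 : ν.real Q ≤ 0 := ge_of_tendsto' hlim hle
    exact (measureReal_eq_zero_iff).1 (le_antisymm h0 measureReal_nonneg)
  have hfull : ν (Set.range (stoneCechUnit : X → StoneCech X)) = ν Set.univ := by
    refine le_antisymm (measure_mono (Set.subset_univ _)) ?_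
    rw [Set.measure_eq_iInf_isOpen (Set.range _)]
    refine le_iInf₂ fun W hW => le_iInf fun hWo => ?_
    have h1 := hnull Wᶜ hWo.isClosed_compl.isCompact
      (Set.disjoint_left.2 fun z hz hz' => hz (hW hz'))
    have h2 := measure_add_measure_compl (μ := ν) hWo.measurableSet
    rw [h1, add_zero] at h2
    exact h2.ge
  have hcomap : MeasurableSpace.comap (stoneCechUnit : X → StoneCech X) inferInstance =
      ‹MeasurableSpace X› := by
    calc _ = MeasurableSpace.comap stoneCechUnit (borel (StoneCech X)) :=
          congrArg _ BorelSpace.measurable_eq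
      _ = @borel X (TopologicalSpace.induced stoneCechUnit inferInstance) := borel_comap.symm
      _ = borel X := congrArg _ isInducing_stoneCechUnit.eq_induced.symm
      _ = _ := BorelSpace.measurable_eq.symm
  obtain ⟨m, hm⟩ := exists_map_eq_of_outer_full _ hcomap ν hfull
  have hmeas : Measurable (stoneCechUnit : X → StoneCech X) :=
    continuous_stoneCechUnit.measurable
  refine ⟨m, ⟨?_⟩, fun f hf => ?_⟩
  · rw [← Set.preimage_univ (f := (stoneCechUnit : X → StoneCech X)),
      ← Measure.map_apply hmeas MeasurableSet.univ, hm]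
    exact measure_lt_top _ _
  · obtain ⟨F, rfl⟩ := exists_restrictStoneCech_eq f
    let G : C_c(StoneCech X, ℝ≥0) :=
      ⟨⟨fun z => Real.toNNReal (F z), by fun_prop⟩, HasCompactSupport.of_compactSpace _⟩
    have hG : restrictNNReal G = restrictStoneCech X F := by
      ext x
      exact Real.coe_toNNReal _ (hf x)
    rw [← hG, ← hint, ← hm, integral_map hmeas.aemeasurable]
    · rfl
    · exact (by fun_prop : Continuous fun z => (G z : ℝ)).aestronglyMeasurable

/-- A bounded `σ`-smooth functional is integration against a signed measure: represent `L⁺` and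
`L⁺ - L`. -/
theorem exists_signedMeasure_of_isSigmaSmooth [SecondCountableTopology X]
    [CompletelyRegularSpace X] [MeasurableSpace X] [BorelSpace X] (L : (X →ᵇ ℝ) →L[ℝ] ℝ)
    (hL : IsSigmaSmooth L) : ∃ μ : SignedMeasure X, ∀ f, integralLM μ f = L f := by
  obtain ⟨m₁, hm₁, h₁⟩ := exists_measure_of_isSigmaSmooth (posPartFun L) hL.posPartFun
    (fun f hf => posPartFun_nonneg L hf) (fun f g hf hg => posPartFun_add L hf hg)
    (fun c f hc hf => posPartFun_smul L hc hf)
  obtain ⟨m₂, hm₂, h₂⟩ := exists_measure_of_isSigmaSmooth (fun f => posPartFun L f - L f)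
    (fun f hf h0 => by simpa using (hL.posPartFun f hf h0).sub (hL f hf h0))
    (fun f hf => sub_nonneg.2 (le_posPartFun L ⟨hf, le_rfl⟩))
    (fun f g hf hg => by rw [posPartFun_add L hf hg, map_add]; ring)
    (fun c f hc hf => by rw [posPartFun_smul L hc hf, map_smul, smul_eq_mul]; ring)
  have key : ∀ f : X →ᵇ ℝ, 0 ≤ f →
      integralLM (m₁.toSignedMeasure - m₂.toSignedMeasure) f = L f := fun f hf => by
    rw [integralLM_sub_toSignedMeasure, ← h₁ f hf, ← h₂ f hf]; ring
  refine ⟨m₁.toSignedMeasure - m₂.toSignedMeasure, fun f => ?_⟩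
  have hc : (0 : X →ᵇ ℝ) ≤ BoundedContinuousFunction.const X ‖f‖ := fun x => norm_nonneg f
  have hfc : 0 ≤ f + BoundedContinuousFunction.const X ‖f‖ := fun x => by
    have h : -‖f‖ ≤ f x := (abs_le.1 (f.norm_coe_le_norm x)).1
    change 0 ≤ f x + ‖f‖
    linarith
  have h := key _ hfc
  rw [map_add, map_add, key _ hc] at h
  exact add_right_cancel h

end Riesz

/-! ### Strictly continuous functionals -/

section StrictDual

variable {X : Type u} [TopologicalSpace X]

theorem continuous_strictTopology_iff (L : (X →ᵇ ℝ) →ₗ[ℝ] ℝ) :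
    Continuous[strictTopology X, inferInstance] L ↔
      ∀ Q : Set (StoneCech X), IsCompact Q → Disjoint Q (Set.range stoneCechUnit) →
        Continuous[strictTopologyAt X Q, inferInstance] L := by
  refine ⟨fun h Q hQ hd => continuous_le_dom (le_sInf fun t ht => ht.2.2.2 Q hQ hd) h,
    fun h => continuous_le_dom (sInf_le ?_) continuous_induced_dom⟩
  exact ⟨topologicalAddGroup_induced L, continuousSMul_induced L,
    LocallyConvexSpace.induced L, fun Q hQ hd => continuous_iff_le_induced.1 (h Q hQ hd)⟩

theorem strictSeminorm_apply (Q : Set (StoneCech X))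
    (h : {h : C(StoneCech X, ℝ) // ∀ q ∈ Q, h q = 0}) (f : X →ᵇ ℝ) :
    strictSeminorm X Q h f = ‖f * restrictStoneCech X h.1‖ := rfl

/-- The seminorms that define `β_Q` are directed up to domination, so that a `β_Q`-continuous
functional is dominated by a single one of them. -/
theorem continuous_strictTopologyAt_iff (Q : Set (StoneCech X)) (L : (X →ᵇ ℝ) →ₗ[ℝ] ℝ) :
    Continuous[strictTopologyAt X Q, inferInstance] L ↔
      ∃ h : C(StoneCech X, ℝ), (∀ q ∈ Q, h q = 0) ∧
        ∃ C : ℝ, 0 ≤ C ∧ ∀ f, |L f| ≤ C * ‖f * restrictStoneCech X h‖ := by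
  let _ : TopologicalSpace (X →ᵇ ℝ) := strictTopologyAt X Q
  have hp : WithSeminorms (strictSeminorm X Q) := ⟨rfl⟩
  constructor
  · intro hL
    obtain ⟨s, C, -, hC⟩ := Seminorm.bound_of_continuous hp ((normSeminorm ℝ ℝ).comp L)
      (continuous_norm.comp hL)
    let H : C(StoneCech X, ℝ) := ∑ i ∈ s, |i.1|
    have hH : ∀ z, H z = ∑ i ∈ s, |i.1 z| := fun z => by
      simp [H, ContinuousMap.sum_apply]
    refine ⟨H, fun q hq => ?_, C, C.2, fun f => ?_⟩
    · rw [hH]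
      exact Finset.sum_eq_zero fun i _ => by rw [i.2 q hq, abs_zero]
    · refine (hC f).trans ?_
      rw [_root_.smul_apply, NNReal.smul_def, smul_eq_mul]
      refine mul_le_mul_of_nonneg_left ?_ C.2
      refine Seminorm.finset_sup_apply_le (norm_nonneg _) fun i hi => ?_
      rw [strictSeminorm_apply]
      refine (BoundedContinuousFunction.norm_le (norm_nonneg _)).2 fun x => ?_
      refine le_trans ?_ (BoundedContinuousFunction.norm_coe_le_norm _ x)
      rw [BoundedContinuousFunction.mul_apply, BoundedContinuousFunction.mul_apply, norm_mul,
        norm_mul, restrictStoneCech_apply, restrictStoneCech_apply, hH]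
      gcongr
      rw [Real.norm_eq_abs]
      exact (Finset.single_le_sum (f := fun i => |i.1 (stoneCechUnit x)|)
        (fun i _ => abs_nonneg _) hi).trans (le_abs_self _)
  · rintro ⟨h, hh, C, hC, hb⟩
    refine hp.continuous_real_rng L ⟨{⟨h, hh⟩}, ⟨C, hC⟩, fun f => ?_⟩
    rw [Finset.sup_singleton]
    exact (le_abs_self _).trans (hb f)

theorem exists_norm_bound_of_continuous_strictTopology {L : (X →ᵇ ℝ) →ₗ[ℝ] ℝ}
    (hL : Continuous[strictTopology X, inferInstance] L) :
    ∃ M : ℝ, ∀ f, ‖L f‖ ≤ M * ‖f‖ := by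
  obtain ⟨h, -, C, hC, hb⟩ := (continuous_strictTopologyAt_iff ∅ L).1
    ((continuous_strictTopology_iff L).1 hL ∅ isCompact_empty (Set.empty_disjoint _))
  refine ⟨C * ‖restrictStoneCech X h‖, fun f => (hb f).trans ?_⟩
  rw [mul_assoc, mul_comm ‖restrictStoneCech X h‖]
  gcongr
  exact norm_mul_le _ _

/-- The truncation `(f - ε)⁺`. -/
noncomputable def truncate (ε : ℝ) (f : X →ᵇ ℝ) : X →ᵇ ℝ :=
  (f - BoundedContinuousFunction.const X ε) ⊔ 0

theorem truncate_apply (ε : ℝ) (f : X →ᵇ ℝ) (x : X) : truncate ε f x = max (f x - ε) 0 := rfl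

theorem norm_sub_truncate_le {ε : ℝ} (hε : 0 ≤ ε) {f : X →ᵇ ℝ} (hf : 0 ≤ f) :
    ‖f - truncate ε f‖ ≤ ε := by
  refine (BoundedContinuousFunction.norm_le hε).2 fun x => ?_
  have h0 : 0 ≤ f x := hf x
  rw [BoundedContinuousFunction.sub_apply, truncate_apply, Real.norm_eq_abs, abs_le]
  rcases max_cases (f x - ε) 0 with h | h <;> constructor <;> linarith

/-- For a norm bounded functional, `σ`-smoothness need only be tested on the truncations
`(f n - ε)⁺`. -/
theorem isSigmaSmooth_of_truncate {L : (X →ᵇ ℝ) →L[ℝ] ℝ}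
    (h : ∀ f : ℕ → X →ᵇ ℝ, Antitone f → (∀ x, Tendsto (fun n => f n x) atTop (𝓝 0)) →
      ∀ ε > 0, Tendsto (fun n => L (truncate ε (f n))) atTop (𝓝 0)) : IsSigmaSmooth L := by
  intro f hf h0
  rw [Metric.tendsto_atTop]
  intro ε hε
  have hM : 0 < ‖L‖ + 1 := by positivity
  obtain ⟨N, hN⟩ := Metric.tendsto_atTop.1
    (h f hf h0 (ε / 2 / (‖L‖ + 1)) (by positivity)) (ε / 2) (by positivity)
  refine ⟨N, fun n hn => ?_⟩
  have h1 := hN n hn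
  rw [Real.dist_eq, sub_zero] at h1 ⊢
  have h2 := L.le_opNorm (f n - truncate (ε / 2 / (‖L‖ + 1)) (f n))
  have h3 := norm_sub_truncate_le (ε := ε / 2 / (‖L‖ + 1)) (by positivity)
    (f := f n) (fun x => nonneg_of_antitone_of_tendsto_zero hf h0 n x)
  have h4 : ‖L‖ * ‖f n - truncate (ε / 2 / (‖L‖ + 1)) (f n)‖ ≤ ε / 2 := by
    calc _ ≤ (‖L‖ + 1) * (ε / 2 / (‖L‖ + 1)) := by gcongr; linarith
      _ = ε / 2 := by field_simp
  rw [map_sub, Real.norm_eq_abs] at h2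
  calc |L (f n)| = |(L (f n) - L (truncate (ε / 2 / (‖L‖ + 1)) (f n))) +
        L (truncate (ε / 2 / (‖L‖ + 1)) (f n))| := by rw [sub_add_cancel]
    _ ≤ _ := abs_add_le _ _
    _ < ε := by linarith

/-- Strictly continuous functionals are `σ`-smooth. If `f n` decreases to `0` and `F n` extends
`f n` to `βX`, then `Q = ⋂ n, {F n ≥ ε}` is disjoint from `X`; where a function that vanishes on `Q`
is at least `δ`, the `f n` are eventually below `ε`, by compactness. -/
theorem isSigmaSmooth_of_continuous_strictTopology (L : (X →ᵇ ℝ) →L[ℝ] ℝ)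
    (hL : Continuous[strictTopology X, inferInstance] (L : (X →ᵇ ℝ) →ₗ[ℝ] ℝ)) :
    IsSigmaSmooth L := by
  refine isSigmaSmooth_of_truncate fun f hf h0 ε hε => ?_
  choose F hF using fun n => exists_restrictStoneCech_eq (f n)
  have hFx : ∀ n x, F n (stoneCechUnit x) = f n x := fun n x => by
    rw [← hF n, restrictStoneCech_apply]
  have hclosed : ∀ n, IsClosed {z | ε ≤ F n z} := fun n =>
    isClosed_le continuous_const (F n).continuous
  set Q := ⋂ n, {z | ε ≤ F n z} with hQ
  have hQc : IsCompact Q := (isClosed_iInter hclosed).isCompact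
  have hQd : Disjoint Q (Set.range stoneCechUnit) := by
    rw [Set.disjoint_left]
    rintro _ hz ⟨x, rfl⟩
    have hz' : ∀ n, ε ≤ f n x := fun n => by
      rw [← hFx]; exact Set.mem_iInter.1 hz n
    exact absurd (ge_of_tendsto' (h0 x) hz') (not_le.2 hε)
  obtain ⟨h, hh, C, hC, hb⟩ := (continuous_strictTopologyAt_iff Q _).1
    ((continuous_strictTopology_iff _).1 hL Q hQc hQd)
  suffices hlim : Tendsto (fun n => ‖truncate ε (f n) * restrictStoneCech X h‖) atTop (𝓝 0) by
    refine squeeze_zero_norm (fun n => hb _) ?_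
    simpa using hlim.const_mul C
  rw [Metric.tendsto_atTop]
  intro η hη
  set δ := η / 2 / (‖f 0‖ + 1) with hδ
  have hf0 : 0 < ‖f 0‖ + 1 := by positivity
  have hδ0 : 0 < δ := by positivity
  have hK : IsCompact {z | δ ≤ |h z|} :=
    (isClosed_le continuous_const (by fun_prop)).isCompact
  obtain ⟨t, ht⟩ := hK.elim_finite_subfamily_closed _ hclosed (by
    rw [← hQ, Set.eq_empty_iff_forall_notMem]
    rintro z ⟨hz, hzQ⟩
    have hz' : δ ≤ |h z| := hz
    rw [hh z hzQ, abs_zero] at hz'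
    exact absurd hz' (not_le.2 hδ0))
  obtain ⟨N, hN⟩ := t.exists_le
  refine ⟨N, fun n hn => ?_⟩
  rw [dist_zero_right, norm_norm]
  refine lt_of_le_of_lt ((BoundedContinuousFunction.norm_le (half_pos hη).le).2 fun x => ?_)
    (half_lt_self hη)
  have hnn : 0 ≤ f n x := nonneg_of_antitone_of_tendsto_zero hf h0 n x
  have hle0 : f n x ≤ ‖f 0‖ :=
    (hf (Nat.zero_le n) x).trans ((le_abs_self _).trans ((f 0).norm_coe_le_norm x))
  rw [BoundedContinuousFunction.mul_apply, truncate_apply, restrictStoneCech_apply, norm_mul,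
    Real.norm_eq_abs, Real.norm_eq_abs, abs_of_nonneg (le_max_right _ _)]
  by_cases hx : δ ≤ |h (stoneCechUnit x)|
  · -- here `f n x < ε`, so the truncation vanishes
    have hlt : f n x < ε := by
      by_contra hcon
      have hmem : stoneCechUnit x ∈ {z | δ ≤ |h z|} ∩ ⋂ i ∈ t, {z | ε ≤ F i z} := by
        refine ⟨hx, Set.mem_iInter₂.2 fun i hi => ?_⟩
        change ε ≤ F i _
        rw [hFx]
        exact (not_lt.1 hcon).trans (hf ((hN i hi).trans hn) x)
      rw [ht] at hmem
      exact hmem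
    rw [max_eq_right (by linarith), zero_mul]
    positivity
  · calc max (f n x - ε) 0 * |h (stoneCechUnit x)| ≤ (‖f 0‖ + 1) * δ := by
          gcongr
          · exact max_le (by linarith) (by positivity)
          · exact (not_le.1 hx).le
      _ = η / 2 := by rw [hδ]; field_simp

end StrictDual

section StrictMeasure

variable {X : Type u} [TopologicalSpace X] [MeasurableSpace X] [BorelSpace X]

/-- A function `h ≥ 0` vanishing on `Q` that decays so slowly towards `Q` that `1 / h` is
integrable: with `h₀ > 0` on `X` and `m {n k * h₀ < 1} ≤ 4⁻ᵏ`, it is the sum of the functions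
`2⁻ᵏ min (1, n k * h₀)`. -/
theorem exists_continuous_integrable_inv [SecondCountableTopology X] (m : Measure X)
    [IsFiniteMeasure m] {Q : Set (StoneCech X)} (hQ : IsCompact Q)
    (hd : Disjoint Q (Set.range stoneCechUnit)) :
    ∃ h : C(StoneCech X, ℝ), (∀ q ∈ Q, h q = 0) ∧ (∀ x, 0 < h (stoneCechUnit x)) ∧
      Integrable (fun x => (h (stoneCechUnit x))⁻¹) m := by
  obtain ⟨h₀, hQ0, hh0, hpos⟩ := exists_continuous_pos_of_disjoint hQ hd
  let i : X → StoneCech X := stoneCechUnit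
  have hic : Continuous i := continuous_stoneCechUnit
  -- `k < n` makes the sets `{n k * h₀ ≥ 1}` cover `X` even where `m` does not see the points
  have hn : ∀ k : ℕ, ∃ n : ℕ, m {x | (n : ℝ) * h₀ (i x) < 1} < (4⁻¹ : ℝ≥0∞) ^ k ∧ k < n := by
    intro k
    have hlim := tendsto_measure_iInter_atTop (μ := m)
      (s := fun n : ℕ => {x | (n : ℝ) * h₀ (i x) < 1})
      (fun n => (isOpen_lt (by fun_prop) continuous_const).measurableSet.nullMeasurableSet)
      (fun n l hnl x hx => lt_of_le_of_lt
        (mul_le_mul_of_nonneg_right (Nat.cast_le.2 hnl) (hh0 _)) hx)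
      ⟨0, measure_ne_top _ _⟩
    have hempty : ⋂ n : ℕ, {x | (n : ℝ) * h₀ (i x) < 1} = ∅ := by
      rw [Set.eq_empty_iff_forall_notMem]
      intro x hx
      obtain ⟨N, hN⟩ := exists_nat_gt (1 / h₀ (i x))
      rw [div_lt_iff₀ (hpos x)] at hN
      exact absurd (Set.mem_iInter.1 hx N) (not_lt.2 hN.le)
    rw [hempty, measure_empty] at hlim
    have h4 : (0 : ℝ≥0∞) < 4⁻¹ ^ k := ENNReal.pow_pos (by simp) k
    exact ((hlim.eventually_lt_const h4).and (eventually_gt_atTop k)).exists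
  choose n hn using hn
  have hg0 : ∀ k z, 0 ≤ min 1 ((n k : ℝ) * h₀ z) := fun k z =>
    le_min zero_le_one (mul_nonneg (Nat.cast_nonneg _) (hh0 z))
  have hb : ∀ k z, ‖(1 / 2 : ℝ) ^ k * min 1 ((n k : ℝ) * h₀ z)‖ ≤ (1 / 2 : ℝ) ^ k := fun k z => by
    rw [Real.norm_of_nonneg (mul_nonneg (by positivity) (hg0 k z))]
    exact mul_le_of_le_one_right (by positivity) (min_le_left _ _)
  have hsum : ∀ z, Summable fun k => (1 / 2 : ℝ) ^ k * min 1 ((n k : ℝ) * h₀ z) := fun z =>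
    Summable.of_norm_bounded summable_geometric_two fun k => hb k z
  let h : C(StoneCech X, ℝ) := ⟨fun z => ∑' k, (1 / 2 : ℝ) ^ k * min 1 ((n k : ℝ) * h₀ z),
    continuous_tsum (fun k => by fun_prop) summable_geometric_two hb⟩
  have hh : ∀ z, h z = ∑' k, (1 / 2 : ℝ) ^ k * min 1 ((n k : ℝ) * h₀ z) := fun z => rfl
  have hge : ∀ k z, 1 ≤ (n k : ℝ) * h₀ z → (1 / 2 : ℝ) ^ k ≤ h z := by
    intro k z hz
    have := (hsum z).le_tsum k fun j _ => mul_nonneg (by positivity) (hg0 j z)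
    rwa [min_eq_left hz, mul_one] at this
  have hex : ∀ x, ∃ k, 1 ≤ (n k : ℝ) * h₀ (i x) := by
    intro x
    obtain ⟨N, hN⟩ := exists_nat_gt (1 / h₀ (i x))
    rw [div_lt_iff₀ (hpos x)] at hN
    have h1 : (N : ℝ) ≤ n N := by exact_mod_cast (hn N).2.le
    exact ⟨N, hN.le.trans (mul_le_mul_of_nonneg_right h1 (hh0 _))⟩
  have hhpos : ∀ x, 0 < h (i x) := by
    intro x
    obtain ⟨k, hk⟩ := hex x
    exact lt_of_lt_of_le (by positivity) (hge k _ hk)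
  refine ⟨h, fun q hq => by simp [hh, hQ0 q hq], hhpos, ?_⟩
  have hmeas : Continuous fun x => (h (i x))⁻¹ :=
    (h.continuous.comp hic).inv₀ fun x => (hhpos x).ne'
  refine ⟨hmeas.aestronglyMeasurable, ?_⟩
  let A : ℕ → Set X := fun k => {x | (n k : ℝ) * h₀ (i x) < 1}
  have hA : ∀ k, MeasurableSet (A k) := fun k =>
    (isOpen_lt (by fun_prop) continuous_const).measurableSet
  -- `1 / h ≤ 2 ^ k` for the least `k` with `x ∉ A k`; if `k = j + 1`, then `x ∈ A j`
  have hle : ∀ x, ‖(h (i x))⁻¹‖ₑ ≤ 1 + ∑' k, (A k).indicator (fun _ => (2 : ℝ≥0∞) ^ (k + 1)) x := by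
    intro x
    classical
    have hfind := Nat.find_spec (hex x)
    have hbound : ‖(h (i x))⁻¹‖ₑ ≤ 2 ^ Nat.find (hex x) := by
      have h1 := inv_anti₀ (by positivity) (hge _ _ hfind)
      rw [one_div, inv_pow, inv_inv] at h1
      rw [Real.enorm_of_nonneg (inv_nonneg.2 (hhpos x).le)]
      refine (ENNReal.ofReal_le_ofReal h1).trans (le_of_eq ?_)
      rw [ENNReal.ofReal_pow zero_le_two, ENNReal.ofReal_ofNat]
    rcases hk : Nat.find (hex x) with _ | j
    · rw [hk, pow_zero] at hbound
      exact hbound.trans le_self_add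
    · rw [hk] at hbound
      have hj : x ∈ A j := not_le.1 (Nat.find_min (hex x) (by omega))
      refine hbound.trans (le_trans ?_ le_add_self)
      refine le_trans (le_of_eq ?_) (ENNReal.le_tsum j)
      rw [Set.indicator_of_mem hj]
  refine lt_of_le_of_lt (lintegral_mono hle) ?_
  rw [lintegral_add_left measurable_const, lintegral_tsum
    fun k => (measurable_const.indicator (hA k)).aemeasurable]
  refine ENNReal.add_lt_top.2 ⟨by simp, ?_⟩
  have h2 : (2 : ℝ≥0∞) * 4⁻¹ = 2⁻¹ := by
    rw [show (4 : ℝ≥0∞) = 2 * 2 by norm_num, ENNReal.mul_inv (by simp) (by simp), ← mul_assoc,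
      ENNReal.mul_inv_cancel (by simp) (by simp), one_mul]
  have hterm : ∀ k, ∫⁻ x, (A k).indicator (fun _ => (2 : ℝ≥0∞) ^ (k + 1)) x ∂m ≤
      2 * (2⁻¹ : ℝ≥0∞) ^ k := by
    intro k
    rw [lintegral_indicator_const (hA k), ← h2, mul_pow, ← mul_assoc, ← pow_succ']
    gcongr
    exact (hn k).1.le
  refine lt_of_le_of_lt (ENNReal.tsum_le_tsum hterm) ?_
  rw [ENNReal.tsum_mul_left, ENNReal.tsum_geometric, ENNReal.one_sub_inv_two, inv_inv]
  finiteness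

/-- Integration against a signed measure is strictly continuous: if `1 / h` is integrable, then
`∫ |f| d|μ| ≤ ‖f h‖ ∫ 1 / h d|μ|`. -/
theorem continuous_strictTopology_integralLM [SecondCountableTopology X] (μ : SignedMeasure X) :
    Continuous[strictTopology X, inferInstance] (integralLM μ) := by
  refine (continuous_strictTopology_iff _).2 fun Q hQ hd => ?_
  obtain ⟨h, hh, hpos, hint⟩ := exists_continuous_integrable_inv μ.variation hQ hd
  refine (continuous_strictTopologyAt_iff Q _).2 ⟨h, hh,
    ∫ x, (h (stoneCechUnit x))⁻¹ ∂μ.variation,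
    integral_nonneg fun x => (inv_pos.2 (hpos x)).le, fun f => ?_⟩
  refine (abs_integralLM_le μ f).trans ?_
  rw [← integral_mul_const]
  refine integral_mono (f.integrable_signedMeasure μ).abs (hint.mul_const _) fun x => ?_
  have h1 := (f * restrictStoneCech X h).norm_coe_le_norm x
  rw [BoundedContinuousFunction.mul_apply, restrictStoneCech_apply, norm_mul, Real.norm_eq_abs,
    Real.norm_of_nonneg (hpos x).le] at h1
  change |f x| ≤ (h (stoneCechUnit x))⁻¹ * _
  rwa [inv_mul_eq_div, le_div_iff₀ (hpos x)]

end StrictMeasure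

/-! ### Weak limits and the duality -/

section UniformTails

/-- By Baire's theorem, a pointwise Cauchy sequence of continuous functions on the Cantor space is
uniformly `ε`-close to one of its terms on some cylinder. -/
theorem exists_cylinder_forall_abs_sub_le {φ : ℕ → (ℕ → Bool) → ℝ} (hc : ∀ n, Continuous (φ n))
    (hφ : ∀ b, CauchySeq fun n => φ n b) {ε : ℝ} (hε : 0 < ε) :
    ∃ (N J : ℕ) (a : ℕ → Bool), ∀ b, (∀ j < J, b j = a j) → ∀ n ≥ N, |φ n b - φ N b| ≤ ε := by
  let E : ℕ → Set (ℕ → Bool) := fun N => {b | ∀ n ≥ N, |φ n b - φ N b| ≤ ε}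
  have hE : ∀ N, IsClosed (E N) := fun N => by
    have : E N = ⋂ n ≥ N, {b | |φ n b - φ N b| ≤ ε} := by
      ext b; simp [E]
    rw [this]
    exact isClosed_biInter fun n _ =>
      isClosed_le ((hc n).sub (hc N)).abs continuous_const
  have hU : ⋃ N, E N = Set.univ := by
    refine Set.eq_univ_of_forall fun b => ?_
    obtain ⟨N, hN⟩ := Metric.cauchySeq_iff'.1 (hφ b) ε hε
    exact Set.mem_iUnion.2 ⟨N, fun n hn => (hN n hn).le⟩
  obtain ⟨N, a, ha⟩ := nonempty_interior_of_iUnion_of_closed hE hU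
  obtain ⟨I, v, hv, hvE⟩ := isOpen_pi_iff.1 isOpen_interior a ha
  obtain ⟨J, hJ⟩ := I.exists_le
  refine ⟨N, J + 1, a, fun b hb => interior_subset (hvE fun j hj => ?_)⟩
  rw [hb j (Nat.lt_succ_of_le (hJ j hj))]
  exact (hv j hj).2

variable {X : Type u} [TopologicalSpace X]

/-- The sum of those increments `u j - u (j + 1)` that are selected by `b`. -/
noncomputable def incrementSum (u : ℕ → X →ᵇ ℝ) (b : ℕ → Bool) (x : X) : ℝ :=
  ∑' j, if b j then u j x - u (j + 1) x else 0

variable {u : ℕ → X →ᵇ ℝ}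

theorem incrementSum_eq_sum {x : X} {M : ℕ} (hM : ∀ j ≥ M, u j x = 0) (b : ℕ → Bool) :
    incrementSum u b x = ∑ j ∈ Finset.range M, if b j then u j x - u (j + 1) x else 0 := by
  refine tsum_eq_sum fun j hj => ?_
  have hj' : M ≤ j := by simpa using hj
  rw [hM j hj', hM (j + 1) (by omega), sub_zero, ite_self]

theorem abs_incrementSum_le (hu : Antitone u) {x : X} {M : ℕ} (hM : ∀ j ≥ M, u j x = 0)
    (b : ℕ → Bool) : |incrementSum u b x| ≤ u 0 x := by
  have hd : ∀ j, 0 ≤ u j x - u (j + 1) x := fun j => sub_nonneg.2 (hu (Nat.le_succ j) x)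
  rw [incrementSum_eq_sum hM, abs_of_nonneg (Finset.sum_nonneg fun j _ => by
    split_ifs
    exacts [hd j, le_rfl])]
  calc _ ≤ ∑ j ∈ Finset.range M, (u j x - u (j + 1) x) := Finset.sum_le_sum fun j _ => by
        split_ifs
        exacts [le_rfl, hd j]
    _ = u 0 x := by rw [Finset.sum_range_sub' (fun j => u j x), hM M le_rfl, sub_zero]

theorem continuous_incrementSum
    (hloc : ∀ x, ∃ M, ∀ᶠ y in 𝓝 x, ∀ j ≥ M, u j y = 0) (b : ℕ → Bool) :
    Continuous (incrementSum u b) := by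
  refine continuous_iff_continuousAt.2 fun x => ?_
  obtain ⟨M, hM⟩ := hloc x
  have hc : Continuous fun y =>
      ∑ j ∈ Finset.range M, if b j then u j y - u (j + 1) y else 0 := by
    refine continuous_finsetSum _ fun j _ => ?_
    split_ifs
    exacts [(u j).continuous.sub (u (j + 1)).continuous, continuous_const]
  exact hc.continuousAt.congr (hM.mono fun y hy => (incrementSum_eq_sum hy b).symm)

theorem continuous_incrementSum_left {x : X} {M : ℕ} (hM : ∀ j ≥ M, u j x = 0) :
    Continuous fun b => incrementSum u b x := by
  simp_rw [incrementSum_eq_sum hM]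
  refine continuous_finsetSum _ fun j _ => ?_
  exact (continuous_of_discreteTopology
    (f := fun c : Bool => if c then u j x - u (j + 1) x else 0)).comp (continuous_apply j)

/-- Selecting in addition all indices `≥ k` adds the telescoping sum `u k`. -/
theorem incrementSum_tail {x : X} {M : ℕ} (hM : ∀ j ≥ M, u j x = 0) {a : ℕ → Bool} {J k : ℕ}
    (hk : J ≤ k) :
    incrementSum u (fun j => if j < J then a j else decide (k ≤ j)) x =
      incrementSum u (fun j => if j < J then a j else false) x + u k x := by
  have hM' : ∀ j ≥ max M k, u j x = 0 := fun j hj => hM j (le_trans (le_max_left _ _) hj)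
  rw [incrementSum_eq_sum hM', incrementSum_eq_sum hM', ← sub_eq_iff_eq_add',
    ← Finset.sum_sub_distrib]
  have htel : ∀ m ≥ k, ∑ j ∈ Finset.range m, (if k ≤ j then u j x - u (j + 1) x else 0) =
      u k x - u m x := by
    intro m hm
    induction m, hm using Nat.le_induction with
    | base =>
      rw [sub_self]
      exact Finset.sum_eq_zero fun j hj => if_neg (not_le.2 (Finset.mem_range.1 hj))
    | succ m hm ih => rw [Finset.sum_range_succ, ih, if_pos hm]; ring
  have h := htel _ (le_max_right M k)
  rw [hM' _ le_rfl, sub_zero] at h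
  rw [← h]
  refine Finset.sum_congr rfl fun j _ => ?_
  by_cases h1 : j < J
  · simp [h1, not_le.2 (h1.trans_le hk)]
  · by_cases h2 : k ≤ j <;> simp [h1, h2]

end UniformTails

section WeakLimits

variable {X : Type u} [TopologicalSpace X] [MeasurableSpace X] [BorelSpace X]

/-- If `∫ f dμ n` converges to `L f` for every `f`, then `L (u k) → 0` for every decreasing sequence
`u` that is locally eventually zero: the integrals of the selected increments are continuous on
the Cantor space, and Baire's theorem makes the tails `∫ u k dμ n` uniformly small in `n`. -/
theorem tendsto_of_tendsto_integralLM {μ : ℕ → SignedMeasure X} {L : (X →ᵇ ℝ) → ℝ}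
    (hL : ∀ f, Tendsto (fun n => integralLM (μ n) f) atTop (𝓝 (L f)))
    {u : ℕ → X →ᵇ ℝ} (hu : Antitone u)
    (hloc : ∀ x, ∃ M, ∀ᶠ y in 𝓝 x, ∀ j ≥ M, u j y = 0) :
    Tendsto (fun k => L (u k)) atTop (𝓝 0) := by
  have hpt : ∀ x, ∃ M, ∀ j ≥ M, u j x = 0 := fun x =>
    (hloc x).imp fun M hM => hM.self_of_nhds
  choose M hM using hpt
  have hbound : ∀ b x, ‖incrementSum u b x‖ ≤ ‖u 0‖ := fun b x =>
    (abs_incrementSum_le hu (hM x) b).trans ((le_abs_self _).trans ((u 0).norm_coe_le_norm x))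
  let D : (ℕ → Bool) → X →ᵇ ℝ := fun b => BoundedContinuousFunction.ofNormedAddCommGroup
    (incrementSum u b) (continuous_incrementSum hloc b) ‖u 0‖ (hbound b)
  have hc : ∀ n, Continuous fun b => integralLM (μ n) (D b) := fun n =>
    VectorMeasure.continuous_of_dominated
      (fun b => ((D b).integrable_signedMeasure (μ n)).aestronglyMeasurable)
      (fun b => Eventually.of_forall fun x => hbound b x) (integrable_const ‖u 0‖)
      (Eventually.of_forall fun x => continuous_incrementSum_left (hM x))
  have hu0 : ∀ x, Tendsto (fun k => u k x) atTop (𝓝 0) := fun x =>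
    tendsto_const_nhds.congr' ((eventually_ge_atTop (M x)).mono fun j hj => (hM x j hj).symm)
  rw [Metric.tendsto_atTop]
  intro ε hε
  obtain ⟨N, J, a, hN⟩ := exists_cylinder_forall_abs_sub_le hc
    (fun b => (hL (D b)).cauchySeq) (by positivity : 0 < ε / 4)
  obtain ⟨K, hK⟩ := Metric.tendsto_atTop.1 (tendsto_integralLM (μ N) hu hu0) (ε / 4)
    (by positivity)
  refine ⟨max J K, fun k hk => ?_⟩
  have hJk : J ≤ k := (le_max_left _ _).trans hk
  have h0 := hK k ((le_max_right _ _).trans hk)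
  rw [Real.dist_eq, sub_zero] at h0 ⊢
  have hD : D (fun j => if j < J then a j else decide (k ≤ j)) =
      D (fun j => if j < J then a j else false) + u k := by
    ext x
    exact incrementSum_tail (hM x) hJk
  have hclose : ∀ n ≥ N, |integralLM (μ n) (u k) - integralLM (μ N) (u k)| ≤ ε / 2 := by
    intro n hn
    have h1 := hN (fun j => if j < J then a j else decide (k ≤ j))
      (fun j hj => if_pos hj) n hn
    have h2 := hN (fun j => if j < J then a j else false) (fun j hj => if_pos hj) n hn
    rw [hD, map_add, map_add] at h1
    rw [abs_le] at h1 h2 ⊢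
    constructor <;> linarith [h1.1, h1.2, h2.1, h2.2]
  have hlim := le_of_tendsto ((hL (u k)).sub_const (integralLM (μ N) (u k))).abs
    ((eventually_ge_atTop N).mono hclose)
  rw [abs_le] at hlim
  rw [abs_lt] at h0 ⊢
  constructor <;> linarith [hlim.1, hlim.2]

/-- **Alexandrov's theorem**: a norm bounded pointwise limit of integrals against signed measures
is `σ`-smooth. -/
theorem isSigmaSmooth_of_tendsto_integralLM {μ : ℕ → SignedMeasure X} {L : (X →ᵇ ℝ) →L[ℝ] ℝ}
    (hL : ∀ f, Tendsto (fun n => integralLM (μ n) f) atTop (𝓝 (L f))) : IsSigmaSmooth L := by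
  refine isSigmaSmooth_of_truncate fun f hf h0 ε hε => tendsto_of_tendsto_integralLM hL ?_ ?_
  · intro n m hnm x
    have := hf hnm x
    exact max_le_max_right 0 (sub_le_sub_right this ε)
  · intro x
    obtain ⟨N, hN⟩ := ((h0 x).eventually_lt_const hε).exists
    refine ⟨N, ?_⟩
    filter_upwards [(f N).continuous.continuousAt.eventually_lt_const hN] with y hy j hj
    have h1 : f j y ≤ f N y := hf hj y
    rw [truncate_apply, max_eq_right (by linarith)]

theorem exists_tendsto_integralLM [SecondCountableTopology X] [CompletelyRegularSpace X]
    (μ : ℕ → SignedMeasure X) (hμ : ∀ f, CauchySeq fun n => integralLM (μ n) f) :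
    ∃ ν : SignedMeasure X, ∀ f,
      Tendsto (fun n => integralLM (μ n) f) atTop (𝓝 (integralLM ν f)) := by
  choose L hL using fun f => cauchySeq_tendsto_of_complete (hμ f)
  let T : ℕ → (X →ᵇ ℝ) →L[ℝ] ℝ := fun n => (integralLM (μ n)).mkContinuousOfExistsBound
    (exists_norm_bound_of_continuous_strictTopology (continuous_strictTopology_integralLM (μ n)))
  -- the limit is bounded by the Banach–Steinhaus theorem
  let L' : (X →ᵇ ℝ) →L[ℝ] ℝ := continuousLinearMapOfTendsto T (f := L) (tendsto_pi_nhds.2 hL)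
  obtain ⟨ν, hν⟩ := exists_signedMeasure_of_isSigmaSmooth L'
    (isSigmaSmooth_of_tendsto_integralLM (μ := μ) hL)
  refine ⟨ν, fun f => ?_⟩
  rw [hν]
  exact hL f

end WeakLimits

section Dual

variable (X : Type u) [TopologicalSpace X] [MeasurableSpace X] [BorelSpace X]
  [SecondCountableTopology X]

/-- Integration as a map from `M_τ(X)` to the dual of `(C_b(X), β)`. -/
noncomputable def tauIntegral : TauMeasure X →ₗ[ℝ] WeakDual ℝ (StrictBCF X) where
  toFun μ := (⟨(integralLM (μ : SignedMeasure X)).comp (toStrictBCF X).symm.toLinearMap,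
    continuous_strictTopology_integralLM (μ : SignedMeasure X)⟩ : StrictBCF X →L[ℝ] ℝ)
  map_add' _ _ := ContinuousLinearMap.ext fun f =>
    VectorMeasure.integral_add_vectorMeasure
      (BoundedContinuousFunction.integrable_signedMeasure _ ((toStrictBCF X).symm f))
      (BoundedContinuousFunction.integrable_signedMeasure _ ((toStrictBCF X).symm f))
  map_smul' c _ := ContinuousLinearMap.ext fun f =>
    VectorMeasure.integral_smul_vectorMeasure (fun x => (toStrictBCF X).symm f x) c

variable {X}

theorem tauIntegral_apply (μ : TauMeasure X) (f : X →ᵇ ℝ) :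
    tauIntegral X μ (toStrictBCF X f) = integralLM (μ : SignedMeasure X) f := rfl

theorem tauIntegral_bijective [CompletelyRegularSpace X] [HasOuterApproxClosed X] :
    Function.Bijective (tauIntegral X) := by
  constructor
  · intro μ ν h
    refine Subtype.ext (integralLM_injective (LinearMap.ext fun f => ?_))
    rw [← tauIntegral_apply, ← tauIntegral_apply, h]
  · intro φ
    let l : (X →ᵇ ℝ) →ₗ[ℝ] ℝ :=
      (φ : StrictBCF X →L[ℝ] ℝ).toLinearMap.comp (toStrictBCF X).toLinearMap
    have hl : Continuous[strictTopology X, inferInstance] l :=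
      (φ : StrictBCF X →L[ℝ] ℝ).continuous
    let L : (X →ᵇ ℝ) →L[ℝ] ℝ :=
      l.mkContinuousOfExistsBound (exists_norm_bound_of_continuous_strictTopology hl)
    obtain ⟨μ, hμ⟩ := exists_signedMeasure_of_isSigmaSmooth L
      (isSigmaSmooth_of_continuous_strictTopology L hl)
    exact ⟨⟨μ, isTauAdditive_of_secondCountable μ⟩, ContinuousLinearMap.ext fun f => hμ f⟩

end Dual

theorem lemma1p9 (X : Type u) [TopologicalSpace X] [TopologicalSpace.MetrizableSpace X]
    [TopologicalSpace.SeparableSpace X] [MeasurableSpace X] [BorelSpace X] :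
    -- integration identifies `M_τ(X)` with the continuous dual of `(C_b(X), β)`
    (∃ e : TauMeasure X ≃ₗ[ℝ] WeakDual ℝ (StrictBCF X),
      ∀ (μ : TauMeasure X) (f : X →ᵇ ℝ),
        e μ (toStrictBCF X f) = ∫ᵛ x, f x ∂•(μ : SignedMeasure X)) ∧
    -- this dual is weakly sequentially complete
    IsSequentiallyComplete (WeakDual ℝ (StrictBCF X)) ∧
    -- every `σ(M_τ, C_b)`-Cauchy sequence in `M_τ(X)` converges for `σ(M_τ, C_b)` in `M_τ(X)`
    (∀ μ : ℕ → TauMeasure X,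
      (∀ f : X →ᵇ ℝ, CauchySeq fun n => ∫ᵛ x, f x ∂•(μ n : SignedMeasure X)) →
      ∃ ν : TauMeasure X, ∀ f : X →ᵇ ℝ,
        Tendsto (fun n => ∫ᵛ x, f x ∂•(μ n : SignedMeasure X)) atTop
          (𝓝 (∫ᵛ x, f x ∂•(ν : SignedMeasure X)))) := by
  let _ : MetricSpace X := TopologicalSpace.metrizableSpaceMetric X
  have : SecondCountableTopology X := UniformSpace.secondCountable_of_separable X
  have hseq : ∀ μ : ℕ → TauMeasure X,
      (∀ f : X →ᵇ ℝ, CauchySeq fun n => integralLM (μ n : SignedMeasure X) f) →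
      ∃ ν : TauMeasure X, ∀ f : X →ᵇ ℝ,
        Tendsto (fun n => integralLM (μ n : SignedMeasure X) f) atTop
          (𝓝 (integralLM (ν : SignedMeasure X) f)) := fun μ hμ => by
    obtain ⟨ν, hν⟩ := exists_tendsto_integralLM (fun n => (μ n : SignedMeasure X)) hμ
    exact ⟨⟨ν, isTauAdditive_of_secondCountable ν⟩, hν⟩
  refine ⟨⟨LinearEquiv.ofBijective (tauIntegral X) tauIntegral_bijective, fun μ f => rfl⟩,
    fun φ hφ => ?_, hseq⟩
  choose μ hμ using fun n => tauIntegral_bijective.2 (φ n)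
  obtain ⟨ν, hν⟩ := hseq μ fun f => by
    have h := ((WeakDual.eval_continuous (𝕜 := ℝ) (toStrictBCF X f)).tendsto 0).comp hφ
    rw [cauchySeq_iff_tendsto_dist_atTop_0]
    refine (tendsto_zero_iff_norm_tendsto_zero.1 h).congr fun p => ?_
    rw [dist_eq_norm, ← tauIntegral_apply, ← tauIntegral_apply, hμ, hμ]
    rfl
  refine ⟨tauIntegral X ν, tendsto_iff_forall_eval_tendsto_topDualPairing.2 fun f => ?_⟩
  have h := hν ((toStrictBCF X).symm f)
  simp_rw [← tauIntegral_apply, hμ] at h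
  exact h
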